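/- Consider $k$ identical, anonymous, luminous robots with visible distance $\phi=1$ on the $m\times n$ grid with nodes $v_{i,j}$ ($0\le i<m$, $0\le j<n$), where $v_{i,j}$ and $v_{i',j'}$ are adjacent iff $|i-i'|+|j-j'|=1$. Each robot carries a color from a set $Col$ and repeats Look–Compute–Move cycles. In the Look phase it observes its own color, the multiset of colors of the robots on its own node and, for each of the four directions, whether the adjacent node exists and, if so, the multiset of colors on it. Robots know neither $m$ and $n$ nor the global directions: a snapshot is read up to rotation if the robots have a common chirality, and up to rotation and reflection otherwise. An algorithm is a set of rules (guard = set of views; action = new color together with a move to an existing adjacent node, or staying idle), the same for all robots and all grids. A robot is enabled if one of its rotated (or reflected) views matches a guard; a robot that computes on a snapshot in which it is enabled executes the action of a matching rule in the directions of the matched view, and the scheduler chooses if there are several matches; otherwise it does nothing. In FSYNC all robots execute a full cycle at every instant; in SSYNC a nonempty set of robots chosen by the scheduler does; in ASYNC the scheduler activates the Look, Compute and Move phases of the robots independently (the color changes at the end of Compute, moves are instantaneous, and actions may rest on outdated views). Schedulers are fair: each robot is activated infinitely often. An algorithm solves terminating exploration from an initial configuration if in every execution from it every node is visited by at least one robot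 and from some instant on no robot is enabled. (1) There is a single algorithm with the three colors $\mathsf G,\mathsf W,\mathsf B$ for three robots with $\phi=1$ and a common chirality which, for all $m\ge 2$ and $n\ge 3$, solves terminating exploration of the $m\times n$ grid from the initial configuration $\{(v_{0,0},\{\mathsf G\}),(v_{0,1},\{\mathsf W\}),(v_{0,2},\{\mathsf W\})\}$ in the ASYNC model, and also in the SSYNC and FSYNC models. (2) The number three of robots is optimal in the SSYNC and ASYNC models: for $k\in\{1,2\}$ robots with $\phi=1$, any set of colors, with or without a common chirality, and any $m,n\ge 9$, no algorithm solves terminating exploration of the $m\times n$ grid from any initial configuration, neither in the SSYNC nor in the ASYNC model. In particular, no algorithm for one or two robots solves terminating exploration of all $m\times n$ grids with $m\ge2$, $n\ge3$ in either of these models. -/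

import Mathlib

namespace MyopicRobots

/-- The four directions. As global directions they are the directions on the grid; in the
local frame of a robot, `north`, `east`, `south`, `west` stand for the up, right, down and left
positions of a view. -/
inductive Dir
  | north | east | south | west
  deriving DecidableEq

namespace Dir

/-- Clockwise rotation by a quarter turn. -/
def cw : Dir → Dir
  | north => east
  | east => south
  | south => west
  | west => north

/-- The reflection exchanging left and right. -/
def mirror : Dir → Dir
  | north => north
  | east => west
  | south => south
  | west => east

end Dir

/-- A node `v_{i,j}` of the `m × n` grid: `i` is the row (growing southwards) and `j` is the
column (growing eastwards). -/
abbrev Node (m n : ℕ) : Type := Fin m × Fin n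

/-- The neighbour of a node in a given global direction, `none` if it does not exist. -/
def neighbor {m n : ℕ} (v : Node m n) : Dir → Option (Node m n)
  | .north =>
      if 0 < v.1.val then some (⟨v.1.val - 1, by have := v.1.isLt; omega⟩, v.2) else none
  | .east => if h : v.2.val + 1 < n then some (v.1, ⟨v.2.val + 1, h⟩) else none
  | .south => if h : v.1.val + 1 < m then some (⟨v.1.val + 1, h⟩, v.2) else none
  | .west =>
      if 0 < v.2.val then some (v.1, ⟨v.2.val - 1, by have := v.2.isLt; omega⟩) else none

/-- The node reached from `v` by the movement `mv`, where `none` means staying idle. Rules never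
order a robot to leave the grid (see `Rule.target_exists`). -/
def moveFrom {m n : ℕ} (v : Node m n) : Option Dir → Node m n
  | none => v
  | some d => (neighbor v d).getD v

/-- Positions and colors of `k` robots. The indices of the robots are bookkeeping only: they do
not enter the views. -/
structure Config (k m n : ℕ) (Col : Type*) where
  pos : Fin k → Node m n
  color : Fin k → Col

/-- A view at visible distance one: the color of the observing robot, the multiset of colors on
its own node (its own color included), and, for each of the four directions, the multiset of
colors on the adjacent node, with `none` if there is no such node and `some 0` if that node is
unoccupied. -/
structure View (Col : Type*) where
  color : Col
  center : Multiset Col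
  adj : Dir → Option (Multiset Col)

namespace Config

variable {k m n : ℕ} {Col : Type*}

/-- The multiset of the colors of the robots on node `v`. -/
def colorsAt (C : Config k m n Col) (v : Node m n) : Multiset Col :=
  (Finset.univ.filter (fun r => C.pos r = v)).val.map C.color

/-- The view of robot `r`, written in the global frame (the "North view"). -/
def view (C : Config k m n Col) (r : Fin k) : View Col where
  color := C.color r
  center := C.colorsAt (C.pos r)
  adj d := (neighbor (C.pos r) d).map C.colorsAt

end Config

/-- Whether the robots agree on a common chirality. -/
inductive Chirality
  | common | noCommon

/-- The local frames in which a robot may read its snapshot; a frame sends local directions to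
global ones. With a common chirality these are the four rotations, without one also the four
mirror images. -/
def Chirality.frames : Chirality → Set (Dir → Dir)
  | .common => {f | ∃ a : ℕ, f = Dir.cw^[a]}
  | .noCommon => {f | ∃ a : ℕ, f = Dir.cw^[a] ∨ f = Dir.cw^[a] ∘ Dir.mirror}

/-- The view `V` as it reads in the local frame `f`. -/
def View.inFrame {Col : Type*} (V : View Col) (f : Dir → Dir) : View Col :=
  { V with adj := V.adj ∘ f }

/-- A rule: a guard (the set of views it accepts) and an action, which consists of a new color
and a movement in a direction of the matched view, or no movement (`none`). A robot can only move
to an existing node. -/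
structure Rule (Col : Type*) where
  guard : Set (View Col)
  newColor : Col
  move : Option Dir
  target_exists : ∀ V ∈ guard, ∀ d, move = some d → V.adj d ≠ none

/-- An algorithm is a set of rules. It does not depend on the size of the grid or on the robot. -/
abbrev Algorithm (Col : Type*) := Set (Rule Col)

namespace Algorithm

variable {Col : Type*}

/-- A robot with snapshot `V` is enabled if one of its views matches the guard of a rule. -/
def Enabled (A : Algorithm Col) (χ : Chirality) (V : View Col) : Prop :=
  ∃ f ∈ χ.frames, ∃ ρ ∈ A, V.inFrame f ∈ ρ.guard

/-- `A.Decides χ V c mv`: a robot with snapshot `V` may decide to take the color `c` and to make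
the movement `mv` (in global directions). The choice among several matching combinations of a view
and a rule is left to the scheduler; a robot that is not enabled keeps its color and does not
move. -/
def Decides (A : Algorithm Col) (χ : Chirality) (V : View Col) (c : Col) (mv : Option Dir) :
    Prop :=
  (∃ f ∈ χ.frames, ∃ ρ ∈ A, V.inFrame f ∈ ρ.guard ∧ c = ρ.newColor ∧ mv = ρ.move.map f) ∨
    (¬ A.Enabled χ V ∧ c = V.color ∧ mv = none)

end Algorithm

section Executions

variable {k m n : ℕ} {Col : Type*}

/-- One synchronous step: the robots in `act` execute a full Look-Compute-Move cycle concurrently,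
the others do nothing. -/
def SyncStep (A : Algorithm Col) (χ : Chirality) (act : Set (Fin k))
    (C C' : Config k m n Col) : Prop :=
  ∀ r,
    (r ∈ act → ∃ mv, A.Decides χ (C.view r) (C'.color r) mv ∧
      C'.pos r = moveFrom (C.pos r) mv) ∧
    (r ∉ act → C'.color r = C.color r ∧ C'.pos r = C.pos r)

/-- The state of a robot inside its current asynchronous cycle. -/
inductive Phase (Col : Type*)
  /-- the next phase is Look -/
  | ready
  /-- the Look phase returned the given snapshot; the next phase is Compute -/
  | looked (V : View Col)
  /-- the Compute phase decided the given movement; the next phase is Move -/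
  | computed (mv : Option Dir)

/-- A configuration together with the phases of the robots. -/
structure AsyncState (k m n : ℕ) (Col : Type*) where
  config : Config k m n Col
  phase : Fin k → Phase Col

/-- Robot `r` executes its next phase between `S` and `S'`. The Look phase takes a snapshot of the
current configuration, the color changes at the end of the Compute phase, and the position changes
instantaneously in the Move phase. -/
def AsyncRobotStep (A : Algorithm Col) (χ : Chirality) (S S' : AsyncState k m n Col)
    (r : Fin k) : Prop :=
  match S.phase r with
  | .ready =>
      S'.phase r = .looked (S.config.view r) ∧
        S'.config.color r = S.config.color r ∧ S'.config.pos r = S.config.pos r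
  | .looked V =>
      ∃ mv, A.Decides χ V (S'.config.color r) mv ∧
        S'.phase r = .computed mv ∧ S'.config.pos r = S.config.pos r
  | .computed mv =>
      S'.phase r = .ready ∧
        S'.config.color r = S.config.color r ∧
        S'.config.pos r = moveFrom (S.config.pos r) mv

/-- One asynchronous step: each robot in `act` executes its next phase, the others do nothing. -/
def AsyncStep (A : Algorithm Col) (χ : Chirality) (act : Set (Fin k))
    (S S' : AsyncState k m n Col) : Prop :=
  ∀ r,
    (r ∈ act → AsyncRobotStep A χ S S' r) ∧
    (r ∉ act → S'.phase r = S.phase r ∧ S'.config.color r = S.config.color r ∧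
      S'.config.pos r = S.config.pos r)

/-- A scheduler is fair if it activates each robot infinitely often. -/
def Fair (act : ℕ → Set (Fin k)) : Prop :=
  ∀ r, ∃ᶠ t in Filter.atTop, r ∈ act t

/-- The synchrony models. -/
inductive Synchrony
  | fsync | ssync | async

/-- `IsExecution A χ s C₀ E`: `E 0, E 1, …` are the configurations at the instants `0, 1, …` of an
execution of `A` from `C₀` in the model `s` under a fair scheduler. -/
def IsExecution (A : Algorithm Col) (χ : Chirality) :
    Synchrony → Config k m n Col → (ℕ → Config k m n Col) → Prop
  | .fsync, C₀, E => E 0 = C₀ ∧ ∀ t, SyncStep A χ Set.univ (E t) (E (t + 1))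
  | .ssync, C₀, E =>
      E 0 = C₀ ∧ ∃ act : ℕ → Set (Fin k), Fair act ∧
        ∀ t, (act t).Nonempty ∧ SyncStep A χ (act t) (E t) (E (t + 1))
  | .async, C₀, E =>
      ∃ S : ℕ → AsyncState k m n Col, (∀ t, E t = (S t).config) ∧
        (S 0).config = C₀ ∧ (∀ r, (S 0).phase r = .ready) ∧
        ∃ act : ℕ → Set (Fin k), Fair act ∧ ∀ t, AsyncStep A χ (act t) (S t) (S (t + 1))

/-- Terminating exploration: every node is visited by some robot, and from some instant on no
robot is enabled. -/
def TerminatingExploration (A : Algorithm Col) (χ : Chirality) (E : ℕ → Config k m n Col) : Prop :=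
  (∀ v : Node m n, ∃ t r, (E t).pos r = v) ∧
    ∃ T, ∀ t, T ≤ t → ∀ r, ¬ A.Enabled χ ((E t).view r)

/-- `A` solves terminating exploration of the `m × n` grid from `C₀` in the model `s`. -/
def Solves (A : Algorithm Col) (χ : Chirality) (s : Synchrony) (C₀ : Config k m n Col) : Prop :=
  ∀ E, IsExecution A χ s C₀ E → TerminatingExploration A χ E

end Executions

/-- The set of three colors. -/
inductive Color
  | G | W | B
  deriving DecidableEq

/-- The configuration `{(v_{0,0}, {G}), (v_{0,1}, {W}), (v_{0,2}, {W})}`. -/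
def initialConfig (m n : ℕ) (hm : 2 ≤ m) (hn : 3 ≤ n) : Config 3 m n Color where
  pos := ![(⟨0, by omega⟩, ⟨0, by omega⟩), (⟨0, by omega⟩, ⟨1, by omega⟩),
    (⟨0, by omega⟩, ⟨2, by omega⟩)]
  color := ![.G, .W, .W]

end MyopicRobots

/-! Possibility: the algorithm is sequential. Along its run at most one robot is enabled at a time,
and that robot has a single possible decision (`SoleStep`). Fairness then forces every execution, in
any synchrony model, through the same chain of configurations (`solves_of_soleStep`); in ASYNC one
also needs that no other robot becomes enabled between the color change and the move. The robots
sweep the grid by columns: with `G` on column `j` and `W`, `B` on column `j + 1` they descend to the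
bottom row, gather on column `j + 1`, climb it in a line and turn at the top into the next pair of
columns. Gathering in the last column happens in a corner, where no rule applies. Each step is a
finite check of views, done by evaluating `decisions`.

Impossibility: a robot whose four adjacent nodes exist and are unoccupied has a rotation-invariant
view, so the scheduler chooses the direction of its move. Activating the robots one after another in
complete cycles, the scheduler preserves an invariant on their positions that excludes some node;
such a run is legal in SSYNC and, cut into phases, in ASYNC (`not_solves_of_positions`). For two
robots three invariants, in terms of the distance to `v_{4,4}`, cover all initial positions:
`not_solves_of_safe`, `not_solves_of_central` and `not_solves_of_apart`. Moves that the scheduler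
does not control arise only next to the other robot or on the border, and the invariants absorb
them. -/

namespace MyopicRobots

/-! ### Sequential runs do not depend on the synchrony model. -/

section Sequential

variable {k m n : ℕ} {Col : Type*} {A : Algorithm Col} {χ : Chirality}

/-- The configuration after robot `r` has taken the color `c` and made the movement `mv`. -/
def Config.act (C : Config k m n Col) (r : Fin k) (c : Col) (mv : Option Dir) :
    Config k m n Col where
  pos := Function.update C.pos r (moveFrom (C.pos r) mv)
  color := Function.update C.color r c

theorem Config.ext' {C D : Config k m n Col} (hp : ∀ r, C.pos r = D.pos r)
    (hc : ∀ r, C.color r = D.color r) : C = D := by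
  cases C; cases D
  simp only [Config.mk.injEq]
  exact ⟨funext hp, funext hc⟩

theorem Algorithm.Decides.of_not_enabled {V : View Col} {c : Col} {mv : Option Dir}
    (h : A.Decides χ V c mv) (hV : ¬ A.Enabled χ V) : c = V.color ∧ mv = none := by
  rcases h with ⟨f, hf, ρ, hρ, hg, -⟩ | ⟨-, h⟩
  · exact absurd ⟨f, hf, ρ, hρ, hg⟩ hV
  · exact h

/-- In `C` only one robot may be enabled; it has only one possible decision, which leads to `C'`,
and no other robot is enabled between its Compute and its Move phase either. -/
def SoleStep (A : Algorithm Col) (χ : Chirality) (C C' : Config k m n Col) : Prop :=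
  ∃ r c mv, (∀ q ≠ r, ¬ A.Enabled χ (C.view q)) ∧
    (∀ q ≠ r, ¬ A.Enabled χ ((C.act r c none).view q)) ∧
    (∀ c' mv', A.Decides χ (C.view r) c' mv' → c' = c ∧ mv' = mv) ∧ C' = C.act r c mv

/-- No robot is enabled in `C`. -/
def Halted (A : Algorithm Col) (χ : Chirality) (C : Config k m n Col) : Prop :=
  ∀ q, ¬ A.Enabled χ (C.view q)

/-- The leads-to principle used for every liveness claim here: a property that can be lost only when
`r` acts is traded for `Q` at the next activation of `r`, which fairness supplies. -/
theorem exists_of_fair {act : ℕ → Set (Fin k)} (hact : Fair act) (r : Fin k) {P Q : ℕ → Prop}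
    (stay : ∀ t, P t → r ∉ act t → P (t + 1)) (go : ∀ t, P t → r ∈ act t → Q (t + 1))
    {t : ℕ} (ht : P t) : ∃ t', Q t' := by
  obtain ⟨b, hb, hr⟩ := Filter.frequently_atTop.1 (hact r) t
  obtain ⟨d, rfl⟩ := Nat.exists_eq_add_of_le hb
  clear hb
  induction d generalizing t with
  | zero => exact ⟨_, go t ht hr⟩
  | succ d ih =>
    by_cases h : r ∈ act t
    · exact ⟨_, go t ht h⟩
    · exact ih (stay t ht h) (by rwa [Nat.add_assoc, Nat.add_comm 1 d])

theorem SyncStep.eq_act {act : Set (Fin k)} {C C' : Config k m n Col}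
    (h : SyncStep A χ act C C') {r : Fin k} {c : Col} {mv : Option Dir}
    (hq : ∀ q ≠ r, ¬ A.Enabled χ (C.view q))
    (hr : ∀ c' mv', A.Decides χ (C.view r) c' mv' → c' = c ∧ mv' = mv) (hmem : r ∈ act) :
    C' = C.act r c mv := by
  have key : ∀ q, C'.color q = (C.act r c mv).color q ∧ C'.pos q = (C.act r c mv).pos q := by
    intro q
    by_cases hqr : q = r
    · subst hqr
      obtain ⟨mv', hd, hp⟩ := (h q).1 hmem
      obtain ⟨h1, rfl⟩ := hr _ _ hd
      simp [Config.act, h1, hp]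
    · by_cases hqa : q ∈ act
      · obtain ⟨mv', hd, hp⟩ := (h q).1 hqa
        obtain ⟨h1, rfl⟩ := hd.of_not_enabled (hq q hqr)
        simp [Config.act, h1, hp, hqr, moveFrom, Config.view]
      · obtain ⟨h1, h2⟩ := (h q).2 hqa
        simp [Config.act, h1, h2, hqr]
  exact Config.ext' (fun q => (key q).2) fun q => (key q).1

theorem SyncStep.eq_self {act : Set (Fin k)} {C C' : Config k m n Col}
    (h : SyncStep A χ act C C') (hq : ∀ q ∈ act, ¬ A.Enabled χ (C.view q)) : C' = C := by
  have key : ∀ q, C'.color q = C.color q ∧ C'.pos q = C.pos q := by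
    intro q
    by_cases hqa : q ∈ act
    · obtain ⟨mv', hd, hp⟩ := (h q).1 hqa
      obtain ⟨h1, rfl⟩ := hd.of_not_enabled (hq q hqa)
      simp [h1, hp, moveFrom, Config.view]
    · exact (h q).2 hqa
  exact Config.ext' (fun q => (key q).2) fun q => (key q).1

theorem exists_eq_of_sync {act : ℕ → Set (Fin k)} (hact : Fair act)
    {E : ℕ → Config k m n Col} (hE : ∀ t, SyncStep A χ (act t) (E t) (E (t + 1)))
    {C : Config k m n Col} (h : Relation.ReflTransGen (SoleStep A χ) (E 0) C) :
    ∃ t, E t = C := by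
  induction h with
  | refl => exact ⟨0, rfl⟩
  | tail _ hstep ih =>
    obtain ⟨t, ht⟩ := ih
    obtain ⟨r, c, mv, hq, -, hr, rfl⟩ := hstep
    refine exists_of_fair hact r (P := fun t => E t = _) ?_ ?_ ht
    · rintro t rfl hrt
      exact (hE t).eq_self fun q hqa => hq q fun h => hrt (h ▸ hqa)
    · rintro t rfl hrt
      exact (hE t).eq_act hq hr hrt

/-- A phase of a robot of color `c` from which the robot goes on without changing anything up to
its next Look phase. -/
def Harmless (A : Algorithm Col) (χ : Chirality) (c : Col) : Phase Col → Prop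
  | .ready => True
  | .looked V => ¬ A.Enabled χ V ∧ V.color = c
  | .computed mv => mv = none

/-- An outdated snapshot is dangerous only if it enables its robot. Otherwise Compute writes back
the color recorded in the snapshot, which is still the current one, and orders no move. -/
theorem AsyncStep.harmless {act : Set (Fin k)} {S S' : AsyncState k m n Col}
    (h : AsyncStep A χ act S S') {q : Fin k} (hq : ¬ A.Enabled χ (S.config.view q))
    (hp : Harmless A χ (S.config.color q) (S.phase q)) :
    Harmless A χ (S'.config.color q) (S'.phase q) ∧ S'.config.color q = S.config.color q ∧
      S'.config.pos q = S.config.pos q := by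
  by_cases hqa : q ∈ act
  · have hs := (h q).1 hqa
    unfold AsyncRobotStep at hs
    cases hph : S.phase q with
    | ready =>
      rw [hph] at hs
      obtain ⟨h1, h2, h3⟩ := hs
      refine ⟨?_, h2, h3⟩
      rw [h1, h2]
      exact ⟨hq, rfl⟩
    | looked V =>
      rw [hph] at hs hp
      obtain ⟨mv, h1, h2, h3⟩ := hs
      obtain ⟨h4, rfl⟩ := h1.of_not_enabled hp.1
      rw [h2]
      exact ⟨rfl, h4.trans hp.2, h3⟩
    | computed mv =>
      rw [hph] at hs hp
      obtain ⟨h1, h2, h3⟩ := hs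
      have hmv : mv = none := hp
      subst hmv
      rw [h1]
      exact ⟨trivial, h2, h3⟩
  · obtain ⟨h1, h2, h3⟩ := (h q).2 hqa
    rw [h1, h2]
    exact ⟨hp, rfl, h3⟩

/-- The state `S` has configuration `C`, robot `r` is in a phase that satisfies `P`, and the other
robots are in harmless phases. -/
def Stage (A : Algorithm Col) (χ : Chirality) (r : Fin k) (C : Config k m n Col)
    (P : Phase Col → Prop) (S : AsyncState k m n Col) : Prop :=
  S.config = C ∧ P (S.phase r) ∧ ∀ q ≠ r, Harmless A χ (S.config.color q) (S.phase q)

theorem Stage.stay {act : Set (Fin k)} {S S' : AsyncState k m n Col} {r : Fin k}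
    {C : Config k m n Col} {P : Phase Col → Prop} (h : Stage A χ r C P S)
    (hstep : AsyncStep A χ act S S') (hq : ∀ q ≠ r, ¬ A.Enabled χ (C.view q)) (hr : r ∉ act) :
    Stage A χ r C P S' := by
  obtain ⟨rfl, hP, hH⟩ := h
  obtain ⟨h1, h2, h3⟩ := (hstep r).2 hr
  have key := fun q hqr => hstep.harmless (hq q hqr) (hH q hqr)
  refine ⟨Config.ext' (fun q => ?_) fun q => ?_, by rwa [h1], fun q hqr => (key q hqr).1⟩
  all_goals by_cases hqr : q = r
  · subst hqr; exact h3
  · exact (key q hqr).2.2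
  · subst hqr; exact h2
  · exact (key q hqr).2.1

theorem Stage.go {act : Set (Fin k)} {S S' : AsyncState k m n Col} {r : Fin k}
    {C C' : Config k m n Col} {P P' : Phase Col → Prop} (h : Stage A χ r C P S)
    (hstep : AsyncStep A χ act S S') (hq : ∀ q ≠ r, ¬ A.Enabled χ (C.view q))
    (hC : ∀ q ≠ r, C'.color q = C.color q ∧ C'.pos q = C.pos q)
    (hr : P' (S'.phase r) ∧ S'.config.color r = C'.color r ∧ S'.config.pos r = C'.pos r) :
    Stage A χ r C' P' S' := by
  obtain ⟨rfl, -, hH⟩ := h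
  have key := fun q hqr => hstep.harmless (hq q hqr) (hH q hqr)
  refine ⟨Config.ext' (fun q => ?_) fun q => ?_, hr.1, fun q hqr => (key q hqr).1⟩
  all_goals by_cases hqr : q = r
  · subst hqr; exact hr.2.2
  · exact (key q hqr).2.2.trans (hC q hqr).2.symm
  · subst hqr; exact hr.2.1
  · exact (key q hqr).2.1.trans (hC q hqr).1.symm

/-- The state `S` has configuration `C`, and all robots are in harmless phases. -/
def Clean (A : Algorithm Col) (χ : Chirality) (C : Config k m n Col)
    (S : AsyncState k m n Col) : Prop :=
  S.config = C ∧ ∀ q, Harmless A χ (S.config.color q) (S.phase q)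

theorem exists_clean_of_soleStep {act : ℕ → Set (Fin k)} (hact : Fair act)
    {S : ℕ → AsyncState k m n Col} (hS : ∀ t, AsyncStep A χ (act t) (S t) (S (t + 1)))
    {C C' : Config k m n Col} (h : SoleStep A χ C C') {t : ℕ} (ht : Clean A χ C (S t)) :
    ∃ t', Clean A χ C' (S t') := by
  obtain ⟨r, c, mv, hq, hq', hr, rfl⟩ := h
  -- The stages of the cycle of `r` are treated from the last to the first, so that each one hands
  -- over to one already settled.
  have computedStage : (∃ t, Stage A χ r (C.act r c none) (· = .computed mv) (S t)) →
      ∃ t', Clean A χ (C.act r c mv) (S t') := by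
    rintro ⟨t, ht⟩
    have : ∃ t', Stage A χ r (C.act r c mv) (· = .ready) (S t') := by
      refine exists_of_fair hact r
        (P := fun t => Stage A χ r (C.act r c none) (· = .computed mv) (S t))
        (fun t h hra => h.stay (hS t) hq' hra) (fun t h hra => ?_) ht
      refine h.go (hS t) hq' (fun q hqr => by simp [Config.act, hqr]) ?_
      have hs := (hS t r).1 hra
      unfold AsyncRobotStep at hs
      rw [h.2.1] at hs
      obtain ⟨h1, h2, h3⟩ := hs
      refine ⟨h1, ?_, ?_⟩
      · rw [h2, h.1]; simp [Config.act]
      · rw [h3, h.1]; simp [Config.act, moveFrom]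
    obtain ⟨t', h1, h2, h3⟩ := this
    refine ⟨t', h1, fun q => ?_⟩
    by_cases hqr : q = r
    · subst hqr; rw [h2]; trivial
    · exact h3 q hqr
  have lookedStage : (∃ t, Stage A χ r C (· = .looked (C.view r)) (S t)) →
      ∃ t', Clean A χ (C.act r c mv) (S t') := by
    rintro ⟨t, ht⟩
    refine computedStage ?_
    refine exists_of_fair hact r
        (P := fun t => Stage A χ r C (· = .looked (C.view r)) (S t))
        (fun t h hra => h.stay (hS t) hq hra) (fun t h hra => ?_) ht
    refine h.go (hS t) hq (fun q hqr => by simp [Config.act, hqr]) ?_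
    have hs := (hS t r).1 hra
    unfold AsyncRobotStep at hs
    rw [h.2.1] at hs
    obtain ⟨mv', h1, h2, h3⟩ := hs
    obtain ⟨h4, rfl⟩ := hr _ _ h1
    refine ⟨h2, ?_, ?_⟩
    · rw [h4]; simp [Config.act]
    · rw [h3, h.1]; simp [Config.act, moveFrom]
  have readyStage : (∃ t, Stage A χ r C (· = .ready) (S t)) →
      ∃ t', Clean A χ (C.act r c mv) (S t') := by
    rintro ⟨t, ht⟩
    refine lookedStage ?_
    refine exists_of_fair hact r
        (P := fun t => Stage A χ r C (· = .ready) (S t))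
        (fun t h hra => h.stay (hS t) hq hra) (fun t h hra => ?_) ht
    refine h.go (hS t) hq (fun q hqr => ⟨rfl, rfl⟩) ?_
    have hs := (hS t r).1 hra
    unfold AsyncRobotStep at hs
    rw [h.2.1] at hs
    obtain ⟨h1, h2, h3⟩ := hs
    rw [h.1] at h1 h2 h3
    exact ⟨h1, h2, h3⟩
  -- When `C` is reached, `r` may still be inside an idle cycle begun in an earlier configuration;
  -- it has to finish that cycle before it looks at `C`.
  have idleStage : (∃ t, Stage A χ r C (· = .computed none) (S t)) →
      ∃ t', Clean A χ (C.act r c mv) (S t') := by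
    rintro ⟨t, ht⟩
    refine readyStage ?_
    refine exists_of_fair hact r
        (P := fun t => Stage A χ r C (· = .computed none) (S t))
        (fun t h hra => h.stay (hS t) hq hra) (fun t h hra => ?_) ht
    refine h.go (hS t) hq (fun q hqr => ⟨rfl, rfl⟩) ?_
    have hs := (hS t r).1 hra
    unfold AsyncRobotStep at hs
    rw [h.2.1] at hs
    obtain ⟨h1, h2, h3⟩ := hs
    rw [h.1] at h2 h3
    exact ⟨h1, h2, h3⟩
  have hr0 := ht.2 r
  cases hph : (S t).phase r with
  | ready => exact readyStage ⟨t, ht.1, hph, fun q _ => ht.2 q⟩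
  | computed mv' =>
    rw [hph] at hr0
    have hmv : mv' = none := hr0
    exact idleStage ⟨t, ht.1, hmv ▸ hph, fun q _ => ht.2 q⟩
  | looked V =>
    rw [hph, ht.1] at hr0
    refine idleStage ?_
    refine exists_of_fair hact r (P := fun t => Stage A χ r C (· = .looked V) (S t))
        (fun t h hra => h.stay (hS t) hq hra) (fun t h hra => ?_) ⟨ht.1, hph, fun q _ => ht.2 q⟩
    refine h.go (hS t) hq (fun q hqr => ⟨rfl, rfl⟩) ?_
    have hs := (hS t r).1 hra
    unfold AsyncRobotStep at hs
    rw [h.2.1] at hs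
    obtain ⟨mv', h1, h2, h3⟩ := hs
    obtain ⟨h4, rfl⟩ := h1.of_not_enabled hr0.1
    rw [h.1] at h3
    exact ⟨h2, h4.trans hr0.2, h3⟩

theorem exists_clean_of_reflTransGen {act : ℕ → Set (Fin k)} (hact : Fair act)
    {S : ℕ → AsyncState k m n Col} (hS : ∀ t, AsyncStep A χ (act t) (S t) (S (t + 1)))
    (h0 : ∀ r, (S 0).phase r = .ready) {C : Config k m n Col}
    (h : Relation.ReflTransGen (SoleStep A χ) (S 0).config C) :
    ∃ t, Clean A χ C (S t) := by
  induction h with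
  | refl => exact ⟨0, rfl, fun q => by rw [h0 q]; trivial⟩
  | tail _ hstep ih =>
    obtain ⟨t, ht⟩ := ih
    exact exists_clean_of_soleStep hact hS hstep ht

theorem Clean.of_halted {act : Set (Fin k)} {S S' : AsyncState k m n Col}
    {C : Config k m n Col} (hC : Halted A χ C) (h : Clean A χ C S)
    (hstep : AsyncStep A χ act S S') : Clean A χ C S' := by
  obtain ⟨rfl, h2⟩ := h
  have key := fun q => hstep.harmless (hC q) (h2 q)
  exact ⟨Config.ext' (fun q => (key q).2.2) fun q => (key q).2.1, fun q => (key q).1⟩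

theorem terminatingExploration_of_reaches {C₀ D : Config k m n Col}
    (hD : Halted A χ D) {E : ℕ → Config k m n Col}
    (hreach : ∀ C, Relation.ReflTransGen (SoleStep A χ) C₀ C → ∃ t, E t = C)
    (hfinal : ∃ T, ∀ t, T ≤ t → E t = D)
    (hvis : ∀ v, ∃ C, Relation.ReflTransGen (SoleStep A χ) C₀ C ∧ ∃ r, C.pos r = v) :
    TerminatingExploration A χ E := by
  refine ⟨fun v => ?_, ?_⟩
  · obtain ⟨C, hC, r, hr⟩ := hvis v
    obtain ⟨t, rfl⟩ := hreach C hC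
    exact ⟨t, r, hr⟩
  · obtain ⟨T, hT⟩ := hfinal
    exact ⟨T, fun t ht r => by rw [hT t ht]; exact hD r⟩

theorem terminatingExploration_of_sync {C₀ D : Config k m n Col}
    (h : Relation.ReflTransGen (SoleStep A χ) C₀ D) (hD : Halted A χ D)
    (hvis : ∀ v, ∃ C, Relation.ReflTransGen (SoleStep A χ) C₀ C ∧ ∃ r, C.pos r = v)
    {E : ℕ → Config k m n Col} (h0 : E 0 = C₀) {act : ℕ → Set (Fin k)} (hact : Fair act)
    (hE : ∀ t, SyncStep A χ (act t) (E t) (E (t + 1))) : TerminatingExploration A χ E := by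
  subst h0
  refine terminatingExploration_of_reaches hD (fun C hC => exists_eq_of_sync hact hE hC) ?_ hvis
  obtain ⟨T, hT⟩ := exists_eq_of_sync hact hE h
  refine ⟨T, fun t ht => ?_⟩
  induction t, ht using Nat.le_induction with
  | base => exact hT
  | succ t _ ih =>
    rw [← ih]
    exact (hE t).eq_self fun q _ => by rw [ih]; exact hD q

theorem terminatingExploration_of_async {C₀ D : Config k m n Col}
    (h : Relation.ReflTransGen (SoleStep A χ) C₀ D) (hD : Halted A χ D)
    (hvis : ∀ v, ∃ C, Relation.ReflTransGen (SoleStep A χ) C₀ C ∧ ∃ r, C.pos r = v)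
    {E : ℕ → Config k m n Col} {S : ℕ → AsyncState k m n Col} (hES : ∀ t, E t = (S t).config)
    (h0 : (S 0).config = C₀) (hready : ∀ r, (S 0).phase r = .ready)
    {act : ℕ → Set (Fin k)} (hact : Fair act)
    (hS : ∀ t, AsyncStep A χ (act t) (S t) (S (t + 1))) : TerminatingExploration A χ E := by
  subst h0
  refine terminatingExploration_of_reaches hD (fun C hC => ?_) ?_ hvis
  · obtain ⟨t, ht⟩ := exists_clean_of_reflTransGen hact hS hready hC
    exact ⟨t, (hES t).trans ht.1⟩
  · obtain ⟨T, hT⟩ := exists_clean_of_reflTransGen hact hS hready h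
    have key : ∀ t, T ≤ t → Clean A χ D (S t) := by
      intro t ht
      induction t, ht using Nat.le_induction with
      | base => exact hT
      | succ t _ ih => exact ih.of_halted hD (hS t)
    exact ⟨T, fun t ht => (hES t).trans (key t ht).1⟩

/-- If exactly one robot is enabled at a time, then the synchrony model does not matter. -/
theorem solves_of_soleStep {C₀ D : Config k m n Col}
    (h : Relation.ReflTransGen (SoleStep A χ) C₀ D) (hD : Halted A χ D)
    (hvis : ∀ v, ∃ C, Relation.ReflTransGen (SoleStep A χ) C₀ C ∧ ∃ r, C.pos r = v)
    (s : Synchrony) : Solves A χ s C₀ := by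
  intro E hE
  cases s with
  | fsync =>
    exact terminatingExploration_of_sync h hD hvis hE.1 (act := fun _ => Set.univ)
      (fun r => Filter.Frequently.of_forall fun _ => Set.mem_univ r) hE.2
  | ssync =>
    obtain ⟨h0, act, hact, hstep⟩ := hE
    exact terminatingExploration_of_sync h hD hvis h0 hact fun t => (hstep t).2
  | async =>
    obtain ⟨S, hES, h0, hready, act, hact, hstep⟩ := hE
    exact terminatingExploration_of_async h hD hvis hES h0 hready hact hstep

end Sequential

/-! ### Strategies of the scheduler that keep a node unvisited. -/

section Impossibility

variable {k m n : ℕ} {Col : Type*} {A : Algorithm Col} {χ : Chirality}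

theorem Algorithm.exists_decides (A : Algorithm Col) (χ : Chirality) (V : View Col) :
    ∃ c mv, A.Decides χ V c mv := by
  by_cases h : A.Enabled χ V
  · obtain ⟨f, hf, ρ, hρ, hg⟩ := h
    exact ⟨_, _, Or.inl ⟨f, hf, ρ, hρ, hg, rfl, rfl⟩⟩
  · exact ⟨_, _, Or.inr ⟨h, rfl, rfl⟩⟩

theorem Chirality.exists_frame (χ : Chirality) (d g : Dir) : ∃ f ∈ χ.frames, f d = g := by
  have h : ∃ a : ℕ, Dir.cw^[a] d = g := by
    cases d <;> cases g <;>
      first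
      | exact ⟨0, rfl⟩
      | exact ⟨1, rfl⟩
      | exact ⟨2, rfl⟩
      | exact ⟨3, rfl⟩
  obtain ⟨a, ha⟩ := h
  refine ⟨Dir.cw^[a], ?_, ha⟩
  cases χ
  · exact ⟨a, rfl⟩
  · exact ⟨a, Or.inl rfl⟩

/-- If a robot has the same view in all directions, then the scheduler chooses the direction of
its movement. -/
theorem Algorithm.exists_decides_of_symmetric (A : Algorithm Col) (χ : Chirality) {V : View Col}
    (hV : ∀ d e, V.adj d = V.adj e) (g : Dir) :
    ∃ c mv, A.Decides χ V c mv ∧ (mv = none ∨ mv = some g) := by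
  by_cases h : A.Enabled χ V
  · obtain ⟨f, hf, ρ, hρ, hg⟩ := h
    have hframe : ∀ f' : Dir → Dir, V.inFrame f' = V.inFrame f := fun f' => by
      unfold View.inFrame
      congr 1
      exact funext fun d => hV _ _
    cases hm : ρ.move with
    | none => exact ⟨_, _, Or.inl ⟨f, hf, ρ, hρ, hg, rfl, rfl⟩, Or.inl (by rw [hm]; rfl)⟩
    | some d =>
      obtain ⟨f', hf', hd⟩ := χ.exists_frame d g
      refine ⟨_, _, Or.inl ⟨f', hf', ρ, hρ, by rwa [hframe f'], rfl, rfl⟩, Or.inr ?_⟩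
      rw [hm, ← hd]; rfl
  · exact ⟨_, _, Or.inr ⟨h, rfl, rfl⟩, Or.inl rfl⟩

/-- Robot `q % k` is activated in the `q`-th cycle. -/
def turn (hk : 0 < k) (q : ℕ) : Fin k := ⟨q % k, Nat.mod_lt _ hk⟩

theorem turn_frequently (hk : 0 < k) (r : Fin k) (a : ℕ) : ∃ q ≥ a, turn hk q = r := by
  refine ⟨r + k * a, ?_, Fin.ext ?_⟩
  · have := Nat.le_mul_of_pos_left a hk
    omega
  · simp [turn, Nat.mod_eq_of_lt r.isLt]

/-- A sequence of complete cycles executed by one robot after another. -/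
def CentralRun (A : Algorithm Col) (χ : Chirality) (hk : 0 < k) (F : ℕ → Config k m n Col) :
    Prop :=
  ∀ q, ∃ c mv, A.Decides χ ((F q).view (turn hk q)) c mv ∧ F (q + 1) = (F q).act (turn hk q) c mv

theorem exists_centralRun (hk : 0 < k) {P : Config k m n Col → Prop} {C₀ : Config k m n Col}
    (h0 : P C₀) (hstep : ∀ C r, P C → ∃ c mv, A.Decides χ (C.view r) c mv ∧ P (C.act r c mv)) :
    ∃ F : ℕ → Config k m n Col, F 0 = C₀ ∧ (∀ q, P (F q)) ∧ CentralRun A χ hk F := by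
  choose c mv hd hP using hstep
  let F : ℕ → {C : Config k m n Col // P C} := fun q =>
    Nat.rec ⟨C₀, h0⟩ (fun q C => ⟨_, hP C.1 (turn hk q) C.2⟩) q
  exact ⟨fun q => (F q).1, rfl, fun q => (F q).2, fun q => ⟨_, _, hd _ _ (F q).2, rfl⟩⟩

theorem CentralRun.isExecution_ssync {hk : 0 < k} {F : ℕ → Config k m n Col}
    (h : CentralRun A χ hk F) : IsExecution A χ .ssync (F 0) F := by
  refine ⟨rfl, fun q => {turn hk q}, fun r => ?_, fun q => ⟨Set.singleton_nonempty _, fun r => ?_⟩⟩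
  · refine Filter.frequently_atTop.2 fun a => ?_
    obtain ⟨q, hq, rfl⟩ := turn_frequently hk r a
    exact ⟨q, hq, rfl⟩
  · obtain ⟨c, mv, hd, hF⟩ := h q
    rw [hF]
    constructor
    · rintro rfl
      exact ⟨mv, by simpa [Config.act] using hd, by simp [Config.act]⟩
    · intro hr
      have hr' : r ≠ turn hk q := hr
      simp [Config.act, hr']

/-- Each complete cycle is spread over three instants, one per phase, with all other robots ready.
The intermediate configurations differ from those of `F` only in a color, so no new positions occur.
-/
theorem CentralRun.exists_isExecution_async {hk : 0 < k} {F : ℕ → Config k m n Col}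
    (h : CentralRun A χ hk F) : ∃ E, IsExecution A χ .async (F 0) E ∧
      ∀ t r, ∃ q, (E t).pos r = (F q).pos r := by
  choose c mv hd hF using h
  let S : ℕ → AsyncState k m n Col := fun t =>
    let q := t / 3
    match t % 3 with
    | 0 => ⟨F q, fun _ => .ready⟩
    | 1 => ⟨F q, Function.update (fun _ => .ready) (turn hk q) (.looked ((F q).view (turn hk q)))⟩
    | _ => ⟨(F q).act (turn hk q) (c q) none,
        Function.update (fun _ => .ready) (turn hk q) (.computed (mv q))⟩
  have S0 : ∀ q, S (3 * q) = ⟨F q, fun _ => .ready⟩ := fun q => by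
    have h1 : 3 * q % 3 = 0 := by omega
    have h2 : 3 * q / 3 = q := by omega
    simp only [S, h1, h2]
  have S1 : ∀ q, S (3 * q + 1) = ⟨F q, Function.update (fun _ => .ready) (turn hk q)
      (.looked ((F q).view (turn hk q)))⟩ := fun q => by
    have h1 : (3 * q + 1) % 3 = 1 := by omega
    have h2 : (3 * q + 1) / 3 = q := by omega
    simp only [S, h1, h2]
  have S2 : ∀ q, S (3 * q + 2) = ⟨(F q).act (turn hk q) (c q) none,
      Function.update (fun _ => .ready) (turn hk q) (.computed (mv q))⟩ := fun q => by
    have h1 : (3 * q + 2) % 3 = 2 := by omega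
    have h2 : (3 * q + 2) / 3 = q := by omega
    simp only [S, h1, h2]
  have cases3 : ∀ t : ℕ, ∃ q, t = 3 * q ∨ t = 3 * q + 1 ∨ t = 3 * q + 2 := fun t =>
    ⟨t / 3, by omega⟩
  refine ⟨fun t => (S t).config, ⟨S, fun t => rfl, ?_, ?_, fun t => {turn hk (t / 3)}, ?_, ?_⟩, ?_⟩
  · rw [show S 0 = _ from S0 0]
  · intro r
    rw [show S 0 = _ from S0 0]
  · intro r
    refine Filter.frequently_atTop.2 fun a => ?_
    obtain ⟨q, hq, rfl⟩ := turn_frequently hk r a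
    refine ⟨3 * q, by omega, ?_⟩
    simp only [show 3 * q / 3 = q by omega, Set.mem_singleton_iff]
  · intro t r
    obtain ⟨q, rfl | rfl | rfl⟩ := cases3 t
    · simp only [S0, S1, show 3 * q / 3 = q by omega]
      refine ⟨?_, fun hr => ?_⟩
      · rintro rfl
        simp [AsyncRobotStep]
      · have hr' : r ≠ turn hk q := hr
        simp [hr']
    · simp only [S1, S2, show (3 * q + 1) / 3 = q by omega]
      refine ⟨?_, fun hr => ?_⟩
      · rintro rfl
        simpa [AsyncRobotStep, Config.act, moveFrom] using hd q
      · have hr' : r ≠ turn hk q := hr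
        simp [hr', Config.act]
    · simp only [S2, show 3 * q + 2 + 1 = 3 * (q + 1) by ring, S0,
        show (3 * q + 2) / 3 = q by omega, hF]
      refine ⟨?_, fun hr => ?_⟩
      · rintro rfl
        simp [AsyncRobotStep, Config.act, moveFrom]
      · have hr' : r ≠ turn hk q := hr
        simp [hr', Config.act]
  · intro t r
    obtain ⟨q, rfl | rfl | rfl⟩ := cases3 t
    · exact ⟨q, by simp only [S0]⟩
    · exact ⟨q, by simp only [S1]⟩
    · refine ⟨q, ?_⟩
      simp only [S2]
      by_cases hr : r = turn hk q
      · subst hr; simp [Config.act, moveFrom]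
      · simp [Config.act, hr]

/-- Only the visiting half of terminating exploration is refuted; whether the run terminates is
irrelevant. -/
theorem not_solves_of_avoids (hk : 0 < k) {P : Config k m n Col → Prop} {C₀ : Config k m n Col}
    (h0 : P C₀) (hstep : ∀ C r, P C → ∃ c mv, A.Decides χ (C.view r) c mv ∧ P (C.act r c mv))
    (x : Node m n) (hx : ∀ C r, P C → C.pos r ≠ x) :
    ¬ Solves A χ .ssync C₀ ∧ ¬ Solves A χ .async C₀ := by
  obtain ⟨F, rfl, hP, hF⟩ := exists_centralRun hk h0 hstep
  refine ⟨fun hs => ?_, fun hs => ?_⟩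
  · obtain ⟨t, r, h⟩ := (hs F hF.isExecution_ssync).1 x
    exact hx _ _ (hP t) h
  · obtain ⟨E, hE, hpos⟩ := hF.exists_isExecution_async
    obtain ⟨t, r, h⟩ := (hs E hE).1 x
    obtain ⟨q, hq⟩ := hpos t r
    exact hx _ _ (hP q) (hq ▸ h)

theorem Config.colorsAt_eq_zero {C : Config k m n Col} {w : Node m n} (h : ∀ q, C.pos q ≠ w) :
    C.colorsAt w = 0 := by
  have : Finset.univ.filter (fun r => C.pos r = w) = ∅ :=
    Finset.filter_eq_empty_iff.2 fun q _ => h q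
  simp [Config.colorsAt, this]

/-- The scheduler can keep the robots away from the node `x` if it can preserve a property `Q` of
their positions that excludes `x`: a robot surrounded by four free nodes moves in the direction
that the scheduler wants, any other robot may move to any neighbour. -/
theorem not_solves_of_positions (hk : 0 < k) (Q : (Fin k → Node m n) → Prop)
    (hQ : ∀ p r, Q p → (∀ d w, neighbor (p r) d = some w → Q (Function.update p r w)) ∨
      ((∀ d, ∃ w, neighbor (p r) d = some w ∧ ∀ q, p q ≠ w) ∧
        ∃ d w, neighbor (p r) d = some w ∧ Q (Function.update p r w)))
    (x : Node m n) (hx : ∀ p r, Q p → p r ≠ x) (A : Algorithm Col) (χ : Chirality)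
    (C₀ : Config k m n Col) (h0 : Q C₀.pos) :
    ¬ Solves A χ .ssync C₀ ∧ ¬ Solves A χ .async C₀ := by
  refine not_solves_of_avoids hk (P := fun C => Q C.pos) h0 (fun C r hC => ?_) x
    fun C r hC => hx _ r hC
  have idle : ∀ c, Q (C.act r c none).pos := fun c => by simpa [Config.act, moveFrom] using hC
  rcases hQ C.pos r hC with h | ⟨hfree, d, w, hd, hw⟩
  · obtain ⟨c, mv, hdec⟩ := A.exists_decides χ (C.view r)
    refine ⟨c, mv, hdec, ?_⟩
    cases mv with
    | none => exact idle c
    | some d =>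
      cases hn : neighbor (C.pos r) d with
      | none => simpa [Config.act, moveFrom, hn] using hC
      | some w => simpa [Config.act, moveFrom, hn] using h d w hn
  · have hadj : ∀ d, (C.view r).adj d = some 0 := fun d => by
      obtain ⟨w, h1, h2⟩ := hfree d
      simp [Config.view, h1, Config.colorsAt_eq_zero h2]
    obtain ⟨c, mv, hdec, rfl | rfl⟩ := A.exists_decides_of_symmetric χ (V := C.view r)
      (fun d e => by rw [hadj d, hadj e]) d
    · exact ⟨c, none, hdec, idle c⟩
    · exact ⟨c, some d, hdec, by simpa [Config.act, moveFrom, hd] using hw⟩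

end Impossibility

/-! ### Invariants for one and two robots. -/

section FewRobots

variable {m n : ℕ}

/-- The distance to the node `v_{4,4}`. -/
def centerDist (v : Node m n) : ℕ :=
  (v.1.val - 4) + (4 - v.1.val) + ((v.2.val - 4) + (4 - v.2.val))

/-- The distance between two nodes. -/
def gridDist (v w : Node m n) : ℕ :=
  (v.1.val - w.1.val) + (w.1.val - v.1.val) + ((v.2.val - w.2.val) + (w.2.val - v.2.val))

theorem neighbor_cases {v w : Node m n} {d : Dir} (h : neighbor v d = some w) :
    (w.1.val + 1 = v.1.val ∧ w.2.val = v.2.val) ∨ (w.1.val = v.1.val + 1 ∧ w.2.val = v.2.val) ∨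
    (w.1.val = v.1.val ∧ w.2.val + 1 = v.2.val) ∨ (w.1.val = v.1.val ∧ w.2.val = v.2.val + 1) := by
  cases d <;> simp only [neighbor] at h <;> split_ifs at h with h1 <;>
    obtain rfl := Option.some.inj h <;> simp <;> omega

/-- The node has four neighbours. -/
def Interior (v : Node m n) : Prop :=
  0 < v.1.val ∧ v.1.val + 1 < m ∧ 0 < v.2.val ∧ v.2.val + 1 < n

theorem Interior.exists_neighbor {v : Node m n} (h : Interior v) (d : Dir) :
    ∃ w, neighbor v d = some w := by
  obtain ⟨h1, h2, h3, h4⟩ := h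
  cases d <;> simp [neighbor, h1, h2, h3, h4]

theorem centerDist_neighbor {v w : Node m n} {d : Dir} (h : neighbor v d = some w) :
    centerDist w ≤ centerDist v + 1 ∧ centerDist v ≤ centerDist w + 1 := by
  have := neighbor_cases h
  unfold centerDist
  omega

theorem gridDist_comm (u v : Node m n) : gridDist u v = gridDist v u := by
  unfold gridDist
  omega

theorem centerDist_le_add (u v : Node m n) : centerDist u ≤ centerDist v + gridDist u v := by
  unfold centerDist gridDist
  omega

/-- Parity: a move changes the distance to a fixed node by exactly one. -/
theorem gridDist_neighbor_of_eq_one {u v w : Node m n} {d : Dir} (h : neighbor u d = some w)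
    (huv : gridDist u v = 1) : gridDist w v ≠ 1 := by
  have := neighbor_cases h
  unfold gridDist at *
  omega

/-- The grid is bipartite, so adjacent nodes have center distances of different parity. -/
theorem centerDist_ne_of_gridDist_eq_one {u v : Node m n} (h : gridDist u v = 1) :
    centerDist u ≠ centerDist v := by
  unfold centerDist gridDist at *
  omega

/-- A node at distance one lies on an axis through the center. The chosen move continues along that
axis, and the only neighbour of the new node that is closer to the center is the old one. -/
theorem Interior.exists_away {v : Node m n} (h : Interior v) :
    ∃ d w, neighbor v d = some w ∧ centerDist w = centerDist v + 1 ∧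
      (centerDist v = 1 → ∀ x, gridDist w x ≤ 1 → 2 ≤ centerDist x ∨ gridDist v x = 0) := by
  obtain ⟨h1, h2, h3, h4⟩ := h
  unfold centerDist gridDist
  rcases Nat.lt_trichotomy v.1.val 4 with hi | hi | hi
  · refine ⟨.north, _, if_pos h1, ?_, fun hv x hx => ?_⟩ <;> simp only at * <;> omega
  · by_cases hj : v.2.val ≤ 4
    · refine ⟨.west, _, if_pos h3, ?_, fun hv x hx => ?_⟩ <;> simp only at * <;> omega
    · refine ⟨.east, _, dif_pos h4, ?_, fun hv x hx => ?_⟩ <;> simp only at * <;> omega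
  · refine ⟨.south, _, dif_pos h2, ?_, fun hv x hx => ?_⟩ <;> simp only at * <;> omega

/-- The maximum accounts for the center itself, from which every move leads to distance one. -/
theorem Interior.exists_toward {v : Node m n} (h : Interior v) :
    ∃ d w, neighbor v d = some w ∧ centerDist w ≤ max (centerDist v - 1) 1 := by
  obtain ⟨h1, h2, h3, h4⟩ := h
  unfold centerDist
  rcases Nat.lt_trichotomy v.1.val 4 with hi | hi | hi
  · refine ⟨.south, _, dif_pos h2, ?_⟩
    simp only
    omega
  · rcases Nat.lt_or_ge v.2.val 4 with hj | hj
    · refine ⟨.east, _, dif_pos h4, ?_⟩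
      simp only
      omega
    · refine ⟨.west, _, if_pos h3, ?_⟩
      simp only
      omega
  · refine ⟨.north, _, if_pos h1, ?_⟩
    simp only
    omega

/-- This is where the bound nine enters: every border node is at distance at least four from
`v_{4,4}`. -/
theorem interior_of_centerDist_le (hm : 9 ≤ m) (hn : 9 ≤ n) {v : Node m n}
    (h : centerDist v ≤ 3) : Interior v := by
  unfold centerDist at h
  unfold Interior
  omega

/-- Robots sharing a node still see four free neighbours, so only distance exactly one takes control
away from the scheduler in the interior. -/
theorem not_solves_of_pair (T : Node m n → Node m n → Prop) (hsymm : ∀ u v, T u v → T v u)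
    (hT : ∀ u v, T u v → (∀ d w, neighbor u d = some w → T w v) ∨
      (Interior u ∧ gridDist u v ≠ 1 ∧ ∃ d w, neighbor u d = some w ∧ T w v))
    (x : Node m n) (hx : ∀ v, ¬ T x v) {Col : Type*} (A : Algorithm Col) (χ : Chirality)
    (C₀ : Config 2 m n Col) (h0 : T (C₀.pos 0) (C₀.pos 1)) :
    ¬ Solves A χ .ssync C₀ ∧ ¬ Solves A χ .async C₀ := by
  have key : ∀ (p : Fin 2 → Node m n) (r q : Fin 2), (∀ s, s = r ∨ s = q) → T (p r) (p q) →
      (∀ d w, neighbor (p r) d = some w → T w (p q)) ∨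
      ((∀ d, ∃ w, neighbor (p r) d = some w ∧ ∀ q, p q ≠ w) ∧
        ∃ d w, neighbor (p r) d = some w ∧ T w (p q)) := by
    intro p r q hrq h
    rcases hT _ _ h with h1 | ⟨h1, h2, h3⟩
    · exact Or.inl h1
    · refine Or.inr ⟨fun d => ?_, h3⟩
      obtain ⟨w, hw⟩ := h1.exists_neighbor d
      refine ⟨w, hw, fun s hs => ?_⟩
      have h4 := neighbor_cases hw
      subst hs
      rcases hrq s with rfl | rfl
      · omega
      · apply h2
        unfold gridDist
        omega
  refine not_solves_of_positions (by norm_num) (fun p => T (p 0) (p 1)) (fun p r hp => ?_) x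
    (fun p r hp hr => ?_) A χ C₀ h0
  · fin_cases r
    · simpa using key p 0 1 (by decide) hp
    · rcases key p 1 0 (by decide) (hsymm _ _ hp) with h | ⟨h1, d, w, hw, h⟩
      · exact Or.inl fun d w hw => by simpa using hsymm _ _ (h d w hw)
      · exact Or.inr ⟨h1, d, w, hw, by simpa using hsymm _ _ h⟩
  · subst hr
    fin_cases r
    · exact hx _ hp
    · exact hx _ (hsymm _ _ hp)

/-- The central node `v_{4,4}` can be avoided from all pairs of positions but those close to it. -/
theorem not_solves_of_safe (hm : 9 ≤ m) (hn : 9 ≤ n) {Col : Type*} (A : Algorithm Col)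
    (χ : Chirality) (C₀ : Config 2 m n Col)
    (h0 : 1 ≤ centerDist (C₀.pos 0)) (h1 : 1 ≤ centerDist (C₀.pos 1))
    (h2 : gridDist (C₀.pos 0) (C₀.pos 1) ≤ 1 →
      2 ≤ centerDist (C₀.pos 0) ∧ 2 ≤ centerDist (C₀.pos 1)) :
    ¬ Solves A χ .ssync C₀ ∧ ¬ Solves A χ .async C₀ := by
  refine not_solves_of_pair (fun u v => 1 ≤ centerDist u ∧ 1 ≤ centerDist v ∧
    (gridDist u v ≤ 1 → 2 ≤ centerDist u ∧ 2 ≤ centerDist v)) ?_ ?_ (⟨4, by omega⟩, ⟨4, by omega⟩)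
    ?_ A χ C₀ ⟨h0, h1, h2⟩
  · rintro u v ⟨h1, h2, h3⟩
    exact ⟨h2, h1, fun h => (h3 (gridDist_comm v u ▸ h)).symm⟩
  · rintro u v ⟨h1, h2, h3⟩
    by_cases hu : Interior u ∧ gridDist u v ≠ 1
    · obtain ⟨d, w, hw, hD, hfar⟩ := hu.1.exists_away
      refine Or.inr ⟨hu.1, hu.2, d, w, hw, by omega, h2, fun h => ?_⟩
      have hvw := centerDist_le_add w v
      -- If `u` is at distance one, a close `v` violating the claim would have to be `u` itself, and
      -- `h3` forbids sharing a node at distance one.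
      have hfar := fun h1 => hfar h1 v h
      omega
    · refine Or.inl fun d w hw => ?_
      have hwu := centerDist_neighbor hw
      have hvw := centerDist_le_add w v
      have hwv := centerDist_le_add v w
      have hcomm := gridDist_comm v w
      by_cases hadj : gridDist u v = 1
      · have h4 := gridDist_neighbor_of_eq_one hw hadj
        exact ⟨by omega, h2, fun h => by omega⟩
      · have hi : ¬ Interior u := fun h => hu ⟨h, hadj⟩
        have h4 := mt (interior_of_centerDist_le hm hn) hi
        exact ⟨by omega, h2, fun h => by omega⟩
  · rintro v ⟨h, -⟩
    simp [centerDist] at h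

/-- The corner `v_{0,0}` can be avoided if the robots start close to the central node. -/
theorem not_solves_of_central (hm : 9 ≤ m) (hn : 9 ≤ n) {Col : Type*} (A : Algorithm Col)
    (χ : Chirality) (C₀ : Config 2 m n Col)
    (h0 : (centerDist (C₀.pos 0) ≤ 2 ∧ centerDist (C₀.pos 1) ≤ 2) ∨
      (centerDist (C₀.pos 0) = 3 ∧ centerDist (C₀.pos 1) ≤ 1) ∨
      (centerDist (C₀.pos 0) ≤ 1 ∧ centerDist (C₀.pos 1) = 3)) :
    ¬ Solves A χ .ssync C₀ ∧ ¬ Solves A χ .async C₀ := by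
  refine not_solves_of_pair (fun u v => (centerDist u ≤ 2 ∧ centerDist v ≤ 2) ∨
      (centerDist u = 3 ∧ centerDist v ≤ 1) ∨ (centerDist u ≤ 1 ∧ centerDist v = 3))
    ?_ ?_ (⟨0, by omega⟩, ⟨0, by omega⟩) ?_ A χ C₀ h0
  · intro u v h
    omega
  · intro u v h
    have hu : Interior u := interior_of_centerDist_le hm hn (by omega)
    by_cases h1 : gridDist u v = 1
    · refine Or.inl fun d w hw => ?_
      have hwu := centerDist_neighbor hw
      have huv := centerDist_le_add u v
      have hvu := centerDist_le_add v u
      have hcomm := gridDist_comm u v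
      -- Adjacent robots cannot both be at distance two, so an uncontrolled step to distance three
      -- leaves the other robot at distance at most one.
      have hne := centerDist_ne_of_gridDist_eq_one h1
      omega
    · obtain ⟨d, w, hw, hD⟩ := hu.exists_toward
      refine Or.inr ⟨hu, h1, d, w, hw, by omega⟩
  · intro v h
    simp [centerDist] at h

/-- A node at distance two from the central node can be avoided if one robot starts close to the
central node and the other one far from it. -/
theorem not_solves_of_apart (hm : 9 ≤ m) (hn : 9 ≤ n) {Col : Type*} (A : Algorithm Col)
    (χ : Chirality) (C₀ : Config 2 m n Col)
    (h0 : (centerDist (C₀.pos 0) ≤ 1 ∧ 3 ≤ centerDist (C₀.pos 1)) ∨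
      (3 ≤ centerDist (C₀.pos 0) ∧ centerDist (C₀.pos 1) ≤ 1)) :
    ¬ Solves A χ .ssync C₀ ∧ ¬ Solves A χ .async C₀ := by
  refine not_solves_of_pair (fun u v => (centerDist u ≤ 1 ∧ 3 ≤ centerDist v) ∨
      (3 ≤ centerDist u ∧ centerDist v ≤ 1))
    ?_ ?_ (⟨4, by omega⟩, ⟨6, by omega⟩) ?_ A χ C₀ h0
  · intro u v h
    omega
  · rintro u v h
    have hne : gridDist u v ≠ 1 := by
      have huv := centerDist_le_add u v
      have hvu := centerDist_le_add v u
      have hcomm := gridDist_comm u v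
      omega
    by_cases hu : Interior u
    · refine Or.inr ⟨hu, hne, ?_⟩
      rcases h with h | h
      · obtain ⟨d, w, hw, hD⟩ := hu.exists_toward
        exact ⟨d, w, hw, by omega⟩
      · obtain ⟨d, w, hw, hD, -⟩ := hu.exists_away
        exact ⟨d, w, hw, by omega⟩
    · refine Or.inl fun d w hw => ?_
      have hwu := centerDist_neighbor hw
      have h4 := mt (interior_of_centerDist_le hm hn) hu
      omega
  · intro v h
    simp [centerDist] at h

theorem not_solves_of_two (hm : 9 ≤ m) (hn : 9 ≤ n) {Col : Type*} (A : Algorithm Col)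
    (χ : Chirality) (C₀ : Config 2 m n Col) :
    ¬ Solves A χ .ssync C₀ ∧ ¬ Solves A χ .async C₀ := by
  by_cases h1 : (centerDist (C₀.pos 0) ≤ 1 ∧ 3 ≤ centerDist (C₀.pos 1)) ∨
      (3 ≤ centerDist (C₀.pos 0) ∧ centerDist (C₀.pos 1) ≤ 1)
  · exact not_solves_of_apart hm hn A χ C₀ h1
  by_cases h2 : (centerDist (C₀.pos 0) ≤ 2 ∧ centerDist (C₀.pos 1) ≤ 2) ∨
      (centerDist (C₀.pos 0) = 3 ∧ centerDist (C₀.pos 1) ≤ 1) ∨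
      (centerDist (C₀.pos 0) ≤ 1 ∧ centerDist (C₀.pos 1) = 3)
  · exact not_solves_of_central hm hn A χ C₀ h2
  -- What remains has both robots at distance at least two, which is more than this invariant asks.
  exact not_solves_of_safe hm hn A χ C₀ (by omega) (by omega) fun _ => by omega

theorem not_solves_of_one (hm : 9 ≤ m) (hn : 9 ≤ n) {Col : Type*} (A : Algorithm Col)
    (χ : Chirality) (C₀ : Config 1 m n Col) :
    ¬ Solves A χ .ssync C₀ ∧ ¬ Solves A χ .async C₀ := by
  have free : ∀ (p : Fin 1 → Node m n) (r : Fin 1), Interior (p r) →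
      ∀ d, ∃ w, neighbor (p r) d = some w ∧ ∀ q, p q ≠ w := by
    intro p r h d
    obtain ⟨w, hw⟩ := h.exists_neighbor d
    refine ⟨w, hw, fun q hq => ?_⟩
    have hc := neighbor_cases hw
    rw [Subsingleton.elim r q] at hc
    subst hq
    omega
  by_cases h : centerDist (C₀.pos 0) ≤ 1
  · refine not_solves_of_positions (by norm_num) (fun p => centerDist (p 0) ≤ 1) (fun p r hp => ?_)
      (⟨0, by omega⟩, ⟨0, by omega⟩) (fun p r hp hr => ?_) A χ C₀ h
    · obtain rfl := Subsingleton.elim 0 r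
      have hi : Interior (p 0) := interior_of_centerDist_le hm hn (by omega)
      obtain ⟨d, w, hw, hD⟩ := hi.exists_toward
      refine Or.inr ⟨free p 0 hi, d, w, hw, ?_⟩
      simp only [Function.update_self]
      omega
    · obtain rfl := Subsingleton.elim 0 r
      simp [hr, centerDist] at hp
  · refine not_solves_of_positions (by norm_num) (fun p => 2 ≤ centerDist (p 0))
      (fun p r hp => ?_) (⟨4, by omega⟩, ⟨4, by omega⟩) (fun p r hp hr => ?_) A χ C₀ (by omega)
    · obtain rfl := Subsingleton.elim 0 r
      simp only [Function.update_self]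
      by_cases hi : Interior (p 0)
      · obtain ⟨d, w, hw, hD, -⟩ := hi.exists_away
        exact Or.inr ⟨free p 0 hi, d, w, hw, by omega⟩
      · refine Or.inl fun d w hw => ?_
        have hwu := centerDist_neighbor hw
        have h4 := mt (interior_of_centerDist_le hm hn) hi
        omega
    · obtain rfl := Subsingleton.elim 0 r
      simp [hr, centerDist] at hp

end FewRobots

/-! ### The rules, and a computable list of decisions. -/

section Algorithm

/-- A condition on an adjacent node: it is free, it does not exist, it is free or does not exist,
or it is occupied by robots with the given colors. -/
inductive Pattern
  | free | wall | empty
  | occ (M : Multiset Color)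

def Pattern.Matches : Pattern → Option (Multiset Color) → Bool
  | .free, o => o = some 0
  | .wall, o => o = none
  | .empty, o => o = none ∨ o = some 0
  | .occ M, o => o = some M

/-- A rule given by patterns. -/
structure RuleSpec where
  color : Color
  center : Multiset Color
  north : Pattern
  east : Pattern
  south : Pattern
  west : Pattern
  newColor : Color
  move : Dir

/-- The last conjunct makes `target_exists` automatic, since the pattern at the target need not by
itself guarantee that the node exists. -/
def RuleSpec.Accepts (S : RuleSpec) (V : View Color) : Bool :=
  S.color = V.color && (S.north.Matches (V.adj .north) && (S.east.Matches (V.adj .east) &&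
    (S.south.Matches (V.adj .south) && (S.west.Matches (V.adj .west) &&
    (decide (S.center = V.center) && (V.adj S.move).isSome)))))

def RuleSpec.toRule (S : RuleSpec) : Rule Color where
  guard := {V | S.Accepts V = true}
  newColor := S.newColor
  move := some S.move
  target_exists := by
    rintro V hV d ⟨⟩ h
    simp [RuleSpec.Accepts, h] at hV

/-- The rules of the exploration algorithm. -/
def ruleSpecs : List RuleSpec :=
  -- Rule 1 starts the run, 2 to 4 descend, 5 gathers on the bottom row, 6 leaves the gathering
  -- node, 7 to 9 climb, and 10, 7 and 11 turn at the top. The wall patterns separate the turning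
  -- points from the straight parts.
  [⟨.W, {.W}, .occ {.W}, .empty, .empty, .empty, .B, .north⟩,
   ⟨.G, {.G}, .occ {.B}, .free, .empty, .empty, .G, .east⟩,
   ⟨.B, {.B}, .occ {.W}, .free, .empty, .empty, .B, .north⟩,
   ⟨.W, {.W, .B}, .occ {.G}, .empty, .empty, .free, .W, .west⟩,
   ⟨.G, {.G}, .occ {.W, .B}, .wall, .empty, .empty, .G, .north⟩,
   ⟨.B, {.G, .W, .B}, .free, .free, .wall, .free, .B, .north⟩,
   ⟨.W, {.W}, .occ {.G}, .free, .empty, .free, .W, .north⟩,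
   ⟨.G, {.G, .W}, .occ {.B}, .free, .empty, .free, .G, .north⟩,
   ⟨.B, {.G, .B}, .occ {.W}, .free, .free, .free, .B, .south⟩,
   ⟨.B, {.G, .B}, .occ {.W}, .free, .wall, .free, .B, .west⟩,
   ⟨.W, {.G, .W}, .occ {.B}, .free, .empty, .wall, .W, .north⟩]

/-- The exploration algorithm. -/
def explorer : Algorithm Color := {ρ | ∃ S ∈ ruleSpecs, ρ = S.toRule}

/-- The view with the given contents of the four adjacent nodes. -/
def mkView (c : Color) (M : Multiset Color) (n e s w : Option (Multiset Color)) : View Color where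
  color := c
  center := M
  adj
    | .north => n
    | .east => e
    | .south => s
    | .west => w

/-- All decisions of an enabled robot with the given snapshot. -/
def decisions (V : View Color) : List (Color × Option Dir) :=
  [0, 1, 2, 3].flatMap fun a => (ruleSpecs.filter fun S => S.Accepts (V.inFrame Dir.cw^[a])).map
    fun S => (S.newColor, some (Dir.cw^[a] S.move))

theorem exists_cw_iterate (a : ℕ) : ∃ b ∈ [0, 1, 2, 3], Dir.cw^[a] = Dir.cw^[b] := by
  refine ⟨a % 4, ?_, ?_⟩
  · have := Nat.mod_lt a (show 0 < 4 by norm_num)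
    interval_cases a % 4 <;> simp
  · have h4 : Dir.cw^[4] = id := by
      funext d
      cases d <;> rfl
    conv_lhs => rw [← Nat.mod_add_div a 4]
    rw [Function.iterate_add, Function.iterate_mul, h4, Function.iterate_id, Function.comp_id]

theorem mem_decisions {V : View Color} {x : Color × Option Dir} :
    x ∈ decisions V ↔ ∃ f ∈ Chirality.common.frames, ∃ ρ ∈ explorer,
      V.inFrame f ∈ ρ.guard ∧ x.1 = ρ.newColor ∧ x.2 = ρ.move.map f := by
  simp only [decisions, List.mem_flatMap, List.mem_map, List.mem_filter]
  constructor
  · rintro ⟨a, -, S, ⟨hS, h⟩, rfl⟩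
    exact ⟨_, ⟨a, rfl⟩, _, ⟨S, hS, rfl⟩, h, rfl, rfl⟩
  · rintro ⟨_, ⟨a, rfl⟩, _, ⟨S, hS, rfl⟩, h, h1, h2⟩
    obtain ⟨b, hb, hab⟩ := exists_cw_iterate a
    rw [hab] at h h2
    exact ⟨b, hb, S, ⟨hS, h⟩, Prod.ext h1.symm h2.symm⟩

theorem not_enabled_of_decisions {V : View Color} (h : decisions V = []) :
    ¬ explorer.Enabled .common V := by
  rintro ⟨f, hf, ρ, hρ, hg⟩
  have : (ρ.newColor, ρ.move.map f) ∈ decisions V := mem_decisions.2 ⟨f, hf, ρ, hρ, hg, rfl, rfl⟩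
  simp [h] at this

theorem decides_of_decisions {V : View Color} {c c' : Color} {mv mv' : Option Dir}
    (h : decisions V = [(c, mv)]) (hd : explorer.Decides .common V c' mv') :
    c' = c ∧ mv' = mv := by
  have he : explorer.Enabled .common V := by
    obtain ⟨f, hf, ρ, hρ, hg, -⟩ := mem_decisions.1 (h ▸ List.mem_singleton_self (c, mv))
    exact ⟨f, hf, ρ, hρ, hg⟩
  rcases hd with hd | ⟨hn, -⟩
  · have := mem_decisions (x := (c', mv')).2 hd
    simpa [h] using this
  · exact absurd he hn

end Algorithm

/-! ### Configurations of three robots and their views. -/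

section Grid

variable {m n : ℕ}

/-- The configuration of three robots with the given positions and colors. -/
def three (p₀ p₁ p₂ : Node m n) (c₀ c₁ c₂ : Color) : Config 3 m n Color where
  pos := ![p₀, p₁, p₂]
  color := ![c₀, c₁, c₂]

@[simp] theorem three_pos_zero (p₀ p₁ p₂ : Node m n) (c₀ c₁ c₂ : Color) :
    (three p₀ p₁ p₂ c₀ c₁ c₂).pos 0 = p₀ := rfl

@[simp] theorem three_pos_one (p₀ p₁ p₂ : Node m n) (c₀ c₁ c₂ : Color) :
    (three p₀ p₁ p₂ c₀ c₁ c₂).pos 1 = p₁ := rfl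

@[simp] theorem three_pos_two (p₀ p₁ p₂ : Node m n) (c₀ c₁ c₂ : Color) :
    (three p₀ p₁ p₂ c₀ c₁ c₂).pos 2 = p₂ := rfl

@[simp] theorem three_color_zero (p₀ p₁ p₂ : Node m n) (c₀ c₁ c₂ : Color) :
    (three p₀ p₁ p₂ c₀ c₁ c₂).color 0 = c₀ := rfl

@[simp] theorem three_color_one (p₀ p₁ p₂ : Node m n) (c₀ c₁ c₂ : Color) :
    (three p₀ p₁ p₂ c₀ c₁ c₂).color 1 = c₁ := rfl

@[simp] theorem three_color_two (p₀ p₁ p₂ : Node m n) (c₀ c₁ c₂ : Color) :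
    (three p₀ p₁ p₂ c₀ c₁ c₂).color 2 = c₂ := rfl

@[simp] theorem colorsAt_three (p₀ p₁ p₂ v : Node m n) (c₀ c₁ c₂ : Color) :
    (three p₀ p₁ p₂ c₀ c₁ c₂).colorsAt v = (if p₀ = v then {c₀} else 0) +
      ((if p₁ = v then {c₁} else 0) + (if p₂ = v then {c₂} else 0)) := by
  have h : (Finset.univ : Finset (Fin 3)) = {0, 1, 2} := rfl
  unfold Config.colorsAt
  rw [h, Finset.filter_insert, Finset.filter_insert, Finset.filter_singleton]
  by_cases h0 : p₀ = v <;> by_cases h1 : p₁ = v <;> by_cases h2 : p₂ = v <;>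
    simp [three, h0, h1, h2] <;> first
    | rfl
    | exact Multiset.cons_swap _ _ _

theorem view_three (p₀ p₁ p₂ : Node m n) (c₀ c₁ c₂ : Color) (r : Fin 3) :
    (three p₀ p₁ p₂ c₀ c₁ c₂).view r =
      let C := three p₀ p₁ p₂ c₀ c₁ c₂
      let v := C.pos r
      mkView (C.color r) (C.colorsAt v) ((neighbor v .north).map C.colorsAt)
        ((neighbor v .east).map C.colorsAt) ((neighbor v .south).map C.colorsAt)
        ((neighbor v .west).map C.colorsAt) := by
  unfold Config.view mkView
  simp only [View.mk.injEq, true_and]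
  funext d
  cases d <;> rfl

/-- When the color is kept, the configuration between Compute and Move is `C` itself, so the second
condition of `SoleStep` comes for free. -/
theorem soleStep_of_decisions {C : Config 3 m n Color} (r : Fin 3) (d : Dir)
    (hr : decisions (C.view r) = [(C.color r, some d)])
    (hq : ∀ q ≠ r, decisions (C.view q) = []) {C' : Config 3 m n Color}
    (hC' : C' = C.act r (C.color r) (some d)) : SoleStep explorer .common C C' := by
  have hC : C.act r (C.color r) none = C := by
    simp [Config.act, moveFrom]
  refine ⟨r, _, _, fun q h => not_enabled_of_decisions (hq q h), fun q h => ?_,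
    fun c' mv' h => decides_of_decisions hr h, hC'⟩
  rw [hC]
  exact not_enabled_of_decisions (hq q h)

theorem act_three_zero {p₀ p₁ p₂ w : Node m n} {c₀ c₁ c₂ c : Color} {d : Dir}
    (h : neighbor p₀ d = some w) :
    (three p₀ p₁ p₂ c₀ c₁ c₂).act 0 c (some d) = three w p₁ p₂ c c₁ c₂ := by
  refine Config.ext' (fun r => ?_) fun r => ?_ <;> fin_cases r <;>
    simp [three, Config.act, moveFrom, h]

theorem act_three_one {p₀ p₁ p₂ w : Node m n} {c₀ c₁ c₂ c : Color} {d : Dir}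
    (h : neighbor p₁ d = some w) :
    (three p₀ p₁ p₂ c₀ c₁ c₂).act 1 c (some d) = three p₀ w p₂ c₀ c c₂ := by
  refine Config.ext' (fun r => ?_) fun r => ?_ <;> fin_cases r <;>
    simp [three, Config.act, moveFrom, h]

theorem act_three_two {p₀ p₁ p₂ w : Node m n} {c₀ c₁ c₂ c : Color} {d : Dir}
    (h : neighbor p₂ d = some w) :
    (three p₀ p₁ p₂ c₀ c₁ c₂).act 2 c (some d) = three p₀ p₁ w c₀ c₁ c := by
  refine Config.ext' (fun r => ?_) fun r => ?_ <;> fin_cases r <;>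
    simp [three, Config.act, moveFrom, h]

theorem soleStep_zero {p₀ p₁ p₂ w : Node m n} (d : Dir) (hw : neighbor p₀ d = some w)
    (h0 : decisions ((three p₀ p₁ p₂ .G .W .B).view 0) = [(.G, some d)])
    (h1 : decisions ((three p₀ p₁ p₂ .G .W .B).view 1) = [])
    (h2 : decisions ((three p₀ p₁ p₂ .G .W .B).view 2) = []) :
    SoleStep explorer .common (three p₀ p₁ p₂ .G .W .B) (three w p₁ p₂ .G .W .B) :=
  soleStep_of_decisions 0 d h0 
    (fun q hq => by fin_cases q <;> first | exact absurd rfl hq | assumption) (act_three_zero hw).symm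

theorem soleStep_one {p₀ p₁ p₂ w : Node m n} (d : Dir) (hw : neighbor p₁ d = some w)
    (h0 : decisions ((three p₀ p₁ p₂ .G .W .B).view 0) = [])
    (h1 : decisions ((three p₀ p₁ p₂ .G .W .B).view 1) = [(.W, some d)])
    (h2 : decisions ((three p₀ p₁ p₂ .G .W .B).view 2) = []) :
    SoleStep explorer .common (three p₀ p₁ p₂ .G .W .B) (three p₀ w p₂ .G .W .B) :=
  soleStep_of_decisions 1 d h1 
    (fun q hq => by fin_cases q <;> first | exact absurd rfl hq | assumption) (act_three_one hw).symm

theorem soleStep_two {p₀ p₁ p₂ w : Node m n} (d : Dir) (hw : neighbor p₂ d = some w)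
    (h0 : decisions ((three p₀ p₁ p₂ .G .W .B).view 0) = [])
    (h1 : decisions ((three p₀ p₁ p₂ .G .W .B).view 1) = [])
    (h2 : decisions ((three p₀ p₁ p₂ .G .W .B).view 2) = [(.B, some d)]) :
    SoleStep explorer .common (three p₀ p₁ p₂ .G .W .B) (three p₀ p₁ w .G .W .B) :=
  soleStep_of_decisions 2 d h2 
    (fun q hq => by fin_cases q <;> first | exact absurd rfl hq | assumption) (act_three_two hw).symm

end Grid

/-! ### The individual steps of the run. -/

section Steps

variable {m n : ℕ}

@[simp] theorem add_two_ne_self (x : ℕ) : x + 1 + 1 ≠ x := by omega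

@[simp] theorem self_ne_add_two (x : ℕ) : x ≠ x + 1 + 1 := by omega

@[simp] theorem add_three_ne_self (x : ℕ) : x + 1 + 1 + 1 ≠ x := by omega

@[simp] theorem self_ne_add_three (x : ℕ) : x ≠ x + 1 + 1 + 1 := by omega

/-- The pattern of all step lemmas: splitting on which nearby nodes exist makes each view concrete,
and `decide` then evaluates `decisions`. -/
theorem step_descend_one {i j : ℕ} (hi : i + 1 < m) (hj : j + 1 < n) :
    SoleStep explorer .common
      (three (m := m) (n := n) (⟨i, by omega⟩, ⟨j, by omega⟩) (⟨i, by omega⟩, ⟨j + 1, by omega⟩)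
        (⟨i, by omega⟩, ⟨j + 1, by omega⟩) .G .W .B)
      (three (⟨i, by omega⟩, ⟨j, by omega⟩) (⟨i + 1, by omega⟩, ⟨j + 1, by omega⟩)
        (⟨i, by omega⟩, ⟨j + 1, by omega⟩) .G .W .B) := by
  by_cases h0 : j + 1 + 1 < n
  all_goals
    refine soleStep_one .south (by simp [neighbor, *]) ?_ ?_ ?_ <;> rw [view_three] <;>
      rcases i with _ | i <;> rcases j with _ | j <;>
      simp [neighbor, *] <;> decide

theorem step_descend_zero {i j : ℕ} (hi : i + 1 < m) (hj : j + 1 < n) :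
    SoleStep explorer .common
      (three (m := m) (n := n) (⟨i, by omega⟩, ⟨j, by omega⟩) (⟨i + 1, by omega⟩, ⟨j + 1, by omega⟩)
        (⟨i, by omega⟩, ⟨j + 1, by omega⟩) .G .W .B)
      (three (⟨i + 1, by omega⟩, ⟨j, by omega⟩) (⟨i + 1, by omega⟩, ⟨j + 1, by omega⟩)
        (⟨i, by omega⟩, ⟨j + 1, by omega⟩) .G .W .B) := by
  by_cases h0 : j + 1 + 1 < n <;> by_cases h1 : i + 1 + 1 < m
  all_goals
    refine soleStep_zero .south (by simp [neighbor, *]) ?_ ?_ ?_ <;> rw [view_three] <;>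
      rcases i with _ | i <;> rcases j with _ | j <;>
      simp [neighbor, *] <;> decide

theorem step_descend_two {i j : ℕ} (hi : i + 1 < m) (hj : j + 1 < n) :
    SoleStep explorer .common
      (three (m := m) (n := n) (⟨i + 1, by omega⟩, ⟨j, by omega⟩) (⟨i + 1, by omega⟩, ⟨j + 1, by omega⟩)
        (⟨i, by omega⟩, ⟨j + 1, by omega⟩) .G .W .B)
      (three (⟨i + 1, by omega⟩, ⟨j, by omega⟩) (⟨i + 1, by omega⟩, ⟨j + 1, by omega⟩)
        (⟨i + 1, by omega⟩, ⟨j + 1, by omega⟩) .G .W .B) := by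
  by_cases h0 : j + 1 + 1 < n <;> by_cases h1 : i + 1 + 1 < m
  all_goals
    refine soleStep_two .south (by simp [neighbor, *]) ?_ ?_ ?_ <;> rw [view_three] <;>
      rcases i with _ | i <;> rcases j with _ | j <;>
      simp [neighbor, *] <;> decide

theorem step_gather_zero {i j : ℕ} (hi : i + 2 = m) (hj : j + 1 < n) :
    SoleStep explorer .common
      (three (m := m) (n := n) (⟨i + 1, by omega⟩, ⟨j, by omega⟩) (⟨i + 1, by omega⟩, ⟨j + 1, by omega⟩)
        (⟨i + 1, by omega⟩, ⟨j + 1, by omega⟩) .G .W .B)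
      (three (⟨i + 1, by omega⟩, ⟨j + 1, by omega⟩) (⟨i + 1, by omega⟩, ⟨j + 1, by omega⟩)
        (⟨i + 1, by omega⟩, ⟨j + 1, by omega⟩) .G .W .B) := by
  subst hi
  by_cases h0 : j + 1 + 1 < n
  all_goals
    refine soleStep_zero .east (by simp [neighbor, *]) ?_ ?_ ?_ <;> rw [view_three] <;>
      rcases i with _ | i <;> rcases j with _ | j <;>
      simp [neighbor, *] <;> decide

/-- The bound `hj` provides the free eastern neighbour that rule 6 requires; without it the robots
are in the final corner. -/
theorem step_leave_two {i j : ℕ} (hi : i + 2 = m) (hj : j + 1 + 1 < n) :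
    SoleStep explorer .common
      (three (m := m) (n := n) (⟨i + 1, by omega⟩, ⟨j + 1, by omega⟩) (⟨i + 1, by omega⟩, ⟨j + 1, by omega⟩)
        (⟨i + 1, by omega⟩, ⟨j + 1, by omega⟩) .G .W .B)
      (three (⟨i + 1, by omega⟩, ⟨j + 1, by omega⟩) (⟨i + 1, by omega⟩, ⟨j + 1, by omega⟩)
        (⟨i, by omega⟩, ⟨j + 1, by omega⟩) .G .W .B) := by
  subst hi
  all_goals
    refine soleStep_two .north (by simp [neighbor]) ?_ ?_ ?_ <;> rw [view_three] <;>
      rcases i with _ | i <;> rcases j with _ | j <;>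
      simp [neighbor, *] <;> decide

theorem step_ascend_zero {i j : ℕ} (hi : i + 1 < m) (hj : j + 1 + 1 < n) :
    SoleStep explorer .common
      (three (m := m) (n := n) (⟨i + 1, by omega⟩, ⟨j + 1, by omega⟩) (⟨i + 1, by omega⟩, ⟨j + 1, by omega⟩)
        (⟨i, by omega⟩, ⟨j + 1, by omega⟩) .G .W .B)
      (three (⟨i, by omega⟩, ⟨j + 1, by omega⟩) (⟨i + 1, by omega⟩, ⟨j + 1, by omega⟩)
        (⟨i, by omega⟩, ⟨j + 1, by omega⟩) .G .W .B) := by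
  by_cases h0 : i + 1 + 1 < m <;> by_cases h1 : i + 1 + 1 + 1 < m
  all_goals
    refine soleStep_zero .north (by simp [neighbor]) ?_ ?_ ?_ <;> rw [view_three] <;>
      rcases i with _ | i <;> rcases j with _ | j <;>
      simp [neighbor, *] <;> decide

theorem step_ascend_two {i j : ℕ} (hi : i + 1 + 1 < m) (hj : j + 1 + 1 < n) :
    SoleStep explorer .common
      (three (m := m) (n := n) (⟨i + 1, by omega⟩, ⟨j + 1, by omega⟩) (⟨i + 1 + 1, by omega⟩, ⟨j + 1, by omega⟩)
        (⟨i + 1, by omega⟩, ⟨j + 1, by omega⟩) .G .W .B)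
      (three (⟨i + 1, by omega⟩, ⟨j + 1, by omega⟩) (⟨i + 1 + 1, by omega⟩, ⟨j + 1, by omega⟩)
        (⟨i, by omega⟩, ⟨j + 1, by omega⟩) .G .W .B) := by
  by_cases h0 : i + 1 + 1 + 1 < m
  all_goals
    refine soleStep_two .north (by simp [neighbor]) ?_ ?_ ?_ <;> rw [view_three] <;>
      rcases i with _ | i <;> rcases j with _ | j <;>
      simp [neighbor, *] <;> decide

theorem step_ascend_one {i j : ℕ} (hi : i + 1 + 1 < m) (hj : j + 1 + 1 < n) :
    SoleStep explorer .common
      (three (m := m) (n := n) (⟨i + 1, by omega⟩, ⟨j + 1, by omega⟩) (⟨i + 1 + 1, by omega⟩, ⟨j + 1, by omega⟩)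
        (⟨i, by omega⟩, ⟨j + 1, by omega⟩) .G .W .B)
      (three (⟨i + 1, by omega⟩, ⟨j + 1, by omega⟩) (⟨i + 1, by omega⟩, ⟨j + 1, by omega⟩)
        (⟨i, by omega⟩, ⟨j + 1, by omega⟩) .G .W .B) := by
  have hi' : i + 1 < m := by omega
  by_cases h0 : i + 1 + 1 + 1 < m
  all_goals
    refine soleStep_one .north (by simp [neighbor]) ?_ ?_ ?_ <;> rw [view_three] <;>
      rcases i with _ | i <;> rcases j with _ | j <;>
      simp [neighbor, *] <;> decide

theorem step_turn_two {j : ℕ} (hi : 1 < m) (hj : j + 1 + 1 < n) :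
    SoleStep explorer .common
      (three (m := m) (n := n) (⟨0, by omega⟩, ⟨j + 1, by omega⟩) (⟨1, by omega⟩, ⟨j + 1, by omega⟩)
        (⟨0, by omega⟩, ⟨j + 1, by omega⟩) .G .W .B)
      (three (⟨0, by omega⟩, ⟨j + 1, by omega⟩) (⟨1, by omega⟩, ⟨j + 1, by omega⟩)
        (⟨0, by omega⟩, ⟨j + 1 + 1, by omega⟩) .G .W .B) := by
  by_cases h0 : 1 + 1 < m <;> by_cases h1 : j + 1 + 1 + 1 < n
  all_goals
    refine soleStep_two .east (by simp [neighbor, *]) ?_ ?_ ?_ <;> rw [view_three] <;>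
      rcases j with _ | j <;>
      simp [neighbor, *] <;> decide

theorem step_turn_one_north {j : ℕ} (hi : 1 < m) (hj : j + 1 + 1 < n) :
    SoleStep explorer .common
      (three (m := m) (n := n) (⟨0, by omega⟩, ⟨j + 1, by omega⟩) (⟨1, by omega⟩, ⟨j + 1, by omega⟩)
        (⟨0, by omega⟩, ⟨j + 1 + 1, by omega⟩) .G .W .B)
      (three (⟨0, by omega⟩, ⟨j + 1, by omega⟩) (⟨0, by omega⟩, ⟨j + 1, by omega⟩)
        (⟨0, by omega⟩, ⟨j + 1 + 1, by omega⟩) .G .W .B) := by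
  by_cases h0 : 1 + 1 < m <;> by_cases h1 : j + 1 + 1 + 1 < n
  all_goals
    refine soleStep_one .north (by simp [neighbor]) ?_ ?_ ?_ <;> rw [view_three] <;>
      rcases j with _ | j <;>
      simp [neighbor, *] <;> decide

/-- Read facing `B`, the situation resembles the climb, where `G` would move on. Here the northern
border is on the left: it blocks rule 8 for `G` and triggers rule 11 for `W`. -/
theorem step_turn_one_east {j : ℕ} (hi : 1 < m) (hj : j + 1 + 1 < n) :
    SoleStep explorer .common
      (three (m := m) (n := n) (⟨0, by omega⟩, ⟨j + 1, by omega⟩) (⟨0, by omega⟩, ⟨j + 1, by omega⟩)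
        (⟨0, by omega⟩, ⟨j + 1 + 1, by omega⟩) .G .W .B)
      (three (⟨0, by omega⟩, ⟨j + 1, by omega⟩) (⟨0, by omega⟩, ⟨j + 1 + 1, by omega⟩)
        (⟨0, by omega⟩, ⟨j + 1 + 1, by omega⟩) .G .W .B) := by
  by_cases h0 : 1 + 1 < m <;> by_cases h1 : j + 1 + 1 + 1 < n
  all_goals
    refine soleStep_one .east (by simp [neighbor, *]) ?_ ?_ ?_ <;> rw [view_three] <;>
      rcases j with _ | j <;>
      simp [neighbor, *] <;> decide

/-- The only step that changes a color, so the intermediate configuration has to be examined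
separately. -/
theorem step_start (hm : 2 ≤ m) (hn : 3 ≤ n) :
    SoleStep explorer .common (initialConfig m n hm hn)
      (three (⟨0, by omega⟩, ⟨0, by omega⟩) (⟨0, by omega⟩, ⟨1, by omega⟩)
        (⟨0, by omega⟩, ⟨1, by omega⟩) .G .W .B) := by
  have hC : initialConfig m n hm hn = three (⟨0, by omega⟩, ⟨0, by omega⟩)
    (⟨0, by omega⟩, ⟨1, by omega⟩) (⟨0, by omega⟩, ⟨2, by omega⟩) .G .W .W := rfl
  have hnb : neighbor ((⟨0, by omega⟩, ⟨2, by omega⟩) : Node m n) .west =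
    some (⟨0, by omega⟩, ⟨1, by omega⟩) := by simp [neighbor]
  have hmid : ∀ c, (three (m := m) (n := n) (⟨0, by omega⟩, ⟨0, by omega⟩)
      (⟨0, by omega⟩, ⟨1, by omega⟩) (⟨0, by omega⟩, ⟨2, by omega⟩) .G .W .W).act 2 c none =
      three (⟨0, by omega⟩, ⟨0, by omega⟩) (⟨0, by omega⟩, ⟨1, by omega⟩)
        (⟨0, by omega⟩, ⟨2, by omega⟩) .G .W c := fun c => by
    refine Config.ext' (fun r => ?_) fun r => ?_ <;> fin_cases r <;>
      simp [three, Config.act, moveFrom]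
  have h1 : 1 < m := hm
  have h2 : 1 < n := by omega
  have h3 : 2 < n := hn
  rw [hC]
  refine ⟨2, .B, some .west, fun q hq => not_enabled_of_decisions ?_,
    fun q hq => not_enabled_of_decisions ?_, fun c' mv' h => decides_of_decisions ?_ h,
    (act_three_two hnb).symm⟩
  · rw [view_three]
    fin_cases q
    · simp [neighbor, *]
      decide
    · simp [neighbor, *]
      decide
    · exact absurd rfl hq
  · rw [hmid, view_three]
    fin_cases q
    · simp [neighbor, *]
      decide
    · simp [neighbor, *]
      decide
    · exact absurd rfl hq
  · rw [view_three]
    by_cases h4 : 3 < n <;> simp [neighbor, *] <;> decide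

/-- Rule 6 admits only one wall, and a corner has two. -/
theorem halted_corner {i j : ℕ} (hi : i + 2 = m) (hj : j + 2 = n) :
    Halted explorer .common (three (m := m) (n := n) (⟨i + 1, by omega⟩, ⟨j + 1, by omega⟩)
      (⟨i + 1, by omega⟩, ⟨j + 1, by omega⟩) (⟨i + 1, by omega⟩, ⟨j + 1, by omega⟩) .G .W .B) := by
  subst hi hj
  intro q
  refine not_enabled_of_decisions ?_
  rw [view_three]
  fin_cases q <;> simp [neighbor] <;> decide

end Steps

/-! ### The complete run and the nodes it visits. -/

section Run

variable {m n : ℕ}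

/-- The robots `W` and `B` on `v_{i,j+1}`, and the robot `G` on `v_{i,j}`. -/
def front (i j : ℕ) (hi : i < m) (hj : j + 1 < n) : Config 3 m n Color :=
  three (⟨i, hi⟩, ⟨j, by omega⟩) (⟨i, hi⟩, ⟨j + 1, hj⟩) (⟨i, hi⟩, ⟨j + 1, hj⟩) .G .W .B

theorem front_descends {i j : ℕ} (hi : i < m) (hj : j + 1 < n) :
    Relation.ReflTransGen (SoleStep explorer .common) (front 0 j (by omega) hj)
      (front (m := m) i j hi hj) := by
  induction i with
  | zero => exact .refl
  | succ i ih =>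
    exact (((ih (by omega)).tail (step_descend_one hi hj)).tail (step_descend_zero hi hj)).tail
      (step_descend_two hi hj)

/-- The robots `G`, `W` and `B` go up column `j + 1` in a line and then over to column `j + 2`. -/
theorem line_ascends {i j : ℕ} (hi : i + 1 < m) (hj : j + 1 + 1 < n) :
    Relation.ReflTransGen (SoleStep explorer .common)
      (three (⟨i + 1, by omega⟩, ⟨j + 1, by omega⟩) (⟨i + 1, by omega⟩, ⟨j + 1, by omega⟩)
        (⟨i, by omega⟩, ⟨j + 1, by omega⟩) .G .W .B)
      (front (m := m) 0 (j + 1) (by omega) hj) := by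
  induction i with
  | zero =>
    exact (((Relation.ReflTransGen.single (step_ascend_zero hi hj)).tail
      (step_turn_two hi hj)).tail (step_turn_one_north hi hj)).tail (step_turn_one_east hi hj)
  | succ i ih =>
    exact .head (step_ascend_zero hi hj) (.head (step_ascend_two hi hj)
      (.head (step_ascend_one hi hj) (ih (by omega))))

theorem front_next_column {j : ℕ} (hm : 2 ≤ m) (hj : j + 1 + 1 < n) :
    Relation.ReflTransGen (SoleStep explorer .common) (front (m := m) 0 j (by omega) (by omega))
      (front 0 (j + 1) (by omega) hj) := by
  obtain ⟨i, rfl⟩ := Nat.exists_eq_add_of_le' hm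
  exact (((front_descends (i := i + 1) (by omega) (by omega)).tail
    (step_gather_zero rfl (by omega))).tail (step_leave_two rfl hj)).trans
      (line_ascends (by omega) hj)

theorem initialConfig_reaches_front (hm : 2 ≤ m) (hn : 3 ≤ n) {i j : ℕ} (hi : i < m)
    (hj : j + 1 < n) :
    Relation.ReflTransGen (SoleStep explorer .common) (initialConfig m n hm hn)
      (front i j hi hj) := by
  refine .trans ?_ (front_descends hi hj)
  induction j with
  | zero => exact .single (step_start hm hn)
  | succ j ih => exact (ih (by omega)).trans (front_next_column hm hj)

theorem explorer_solves (hm : 2 ≤ m) (hn : 3 ≤ n) (s : Synchrony) :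
    Solves explorer .common s (initialConfig m n hm hn) := by
  obtain ⟨i, hi⟩ := Nat.exists_eq_add_of_le' hm
  obtain ⟨j, hj⟩ := Nat.exists_eq_add_of_le' (show 2 ≤ n by omega)
  refine solves_of_soleStep ((initialConfig_reaches_front hm hn (i := i + 1) (j := j) (by omega)
    (by omega)).tail (step_gather_zero hi.symm (by omega))) (halted_corner hi.symm hj.symm) ?_ s
  -- Column `0` is visited by `G` during the first descent, and column `b + 1` by `W` during the
  -- descent from `front 0 b`.
  rintro ⟨⟨a, ha⟩, ⟨b, hb⟩⟩
  cases b with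
  | zero => exact ⟨_, initialConfig_reaches_front hm hn ha (j := 0) (by omega), 0, rfl⟩
  | succ b => exact ⟨_, initialConfig_reaches_front hm hn ha hb, 1, rfl⟩

end Run

end MyopicRobots

theorem mainTheorem2 :
    (∃ A : MyopicRobots.Algorithm MyopicRobots.Color,
      ∀ (m n : ℕ) (hm : 2 ≤ m) (hn : 3 ≤ n) (s : MyopicRobots.Synchrony),
        MyopicRobots.Solves A .common s (MyopicRobots.initialConfig m n hm hn)) ∧
    (∀ (k : ℕ), 0 < k → k < 3 →
      ∀ (Col : Type*) (χ : MyopicRobots.Chirality) (A : MyopicRobots.Algorithm Col)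
        (m n : ℕ), 9 ≤ m → 9 ≤ n → ∀ C₀ : MyopicRobots.Config k m n Col,
        ¬ MyopicRobots.Solves A χ .ssync C₀ ∧ ¬ MyopicRobots.Solves A χ .async C₀) := by
  refine ⟨⟨MyopicRobots.explorer, fun m n hm hn s => MyopicRobots.explorer_solves hm hn s⟩, ?_⟩
  intro k hk hk3 Col χ A m n hm hn C₀
  obtain rfl | rfl : k = 1 ∨ k = 2 := by omega
  · exact MyopicRobots.not_solves_of_one hm hn A χ C₀
  · exact MyopicRobots.not_solves_of_two hm hn A χ C₀
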